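/- Let $m\ge 1$ and consider the integro-differential equation $$\dot x(t)+a(t)x(t)+\sum_{l=1}^m b_l(t)\int_{h_l(t)}^t K_l(t,s)\,x(s)\,ds=0 ,\qquad t\ge 0, \tag{E}$$ under the following assumptions. * $a,b_1,\dots,b_m$ are Lebesgue measurable and essentially bounded on $[0,\infty)$, $a(t)\ge a_0>0$ for some constant $a_0$, and $b_l(t)\ge 0$ (almost everywhere). * Each $h_l$ is Lebesgue measurable, $h_l(t)\le t$ for $t\ge 0$, and $\lim_{t\to\infty}h_l(t)=\infty$. * Each $K_l$ is Lebesgue measurable, nonnegative and essentially bounded on $\{(t,s): t\ge 0,\ h_l(t)\le s\le t\}$, and $\int_{h_l(t)}^t K_l(t,s)\,ds=1$ for almost all $t\ge 0$. * $\displaystyle h_0:=\limsup_{t\to\infty}\int_{\min_l h_l(t)}^t a(s)\,ds<\infty .$ * With $\displaystyle \beta:=\limsup_{t\to\infty}\frac{\sum_{l=1}^m b_l(t)}{a(t)}$ (upper limit up to null sets), $$\frac1\beta\, e^{-h_0}>\ln\frac{\beta^2+\beta}{\beta^2+1},$$ where the inequality is regarded as satisfied if $\beta=0$. Then (E) is exponentially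 stable: there exist $M>0$ and $\alpha>0$ such that for every $t_0\ge 0$, every bounded Borel measurable $\varphi:(-\infty,t_0]\to\mathbb R$, and every solution $x$ of the initial value problem at $t_0$ (that is, $x$ is locally absolutely continuous on $[t_0,\infty)$, satisfies (E) for almost every $t\ge t_0$, and $x(t)=\varphi(t)$ for $t\le t_0$), $$|x(t)|\le M\,\Big(\sup_{s\le t_0}|\varphi(s)|\Big)\,e^{-\alpha (t-t_0)},\qquad t\ge t_0 .$$ -/

import Mathlib

open MeasureTheory Set Filter

noncomputable section

/-- `f` is Lebesgue measurable and essentially bounded on `[0, ∞)`. -/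
def EssBoundedMeasurable (f : ℝ → ℝ) : Prop :=
  AEMeasurable f (volume.restrict (Ici 0)) ∧
    ∃ C : ℝ, ∀ᵐ t ∂(volume.restrict (Ici 0)), |f t| ≤ C

/-- `h` is a delay function on `[0, ∞)`: it is Lebesgue measurable, `h t ≤ t` for `t ≥ 0`, and
`h t → ∞` as `t → ∞`. -/
def IsDelay (h : ℝ → ℝ) : Prop :=
  AEMeasurable h (volume.restrict (Ici 0)) ∧ (∀ t, 0 ≤ t → h t ≤ t) ∧ Tendsto h atTop atTop

/-- The set of pairs `(t, s)` with `t ≥ 0` and `h t ≤ s ≤ t`, on which a kernel is defined. -/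
def kernelDomain (h : ℝ → ℝ) : Set (ℝ × ℝ) :=
  {p | 0 ≤ p.1 ∧ h p.1 ≤ p.2 ∧ p.2 ≤ p.1}

/-- `K` is a Lebesgue measurable, nonnegative, essentially bounded kernel with
`∫_{h(t)}^t K(t,s) ds = 1` for almost all `t ≥ 0`. -/
def IsUnitKernel (h : ℝ → ℝ) (K : ℝ → ℝ → ℝ) : Prop :=
  AEMeasurable (Function.uncurry K) (volume.restrict (kernelDomain h)) ∧
    (∀ᵐ p ∂(volume.restrict (kernelDomain h)), 0 ≤ K p.1 p.2) ∧
    (∃ C : ℝ, ∀ᵐ p ∂(volume.restrict (kernelDomain h)), K p.1 p.2 ≤ C) ∧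
    ∀ᵐ t ∂(volume.restrict (Ici 0)), ∫ s in (h t)..t, K t s = 1

/-- `φ` is a bounded Borel measurable function on `(-∞, t₀]`. -/
def IsInitialFunction (t₀ : ℝ) (φ : ℝ → ℝ) : Prop :=
  Measurable (fun s : Iic t₀ => φ s) ∧ ∃ C : ℝ, ∀ s, s ≤ t₀ → |φ s| ≤ C

/-- `x` solves
`x'(t) + a(t) x(t) + ∑ l, b_l(t) ∫_{h_l(t)}^t K_l(t,s) x(s) ds = 0` for `t ≥ t₀`,
`x(t) = φ(t)` for `t ≤ t₀`: it is (locally) absolutely continuous on `[t₀, ∞)`,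
satisfies the equation almost everywhere there, and equals `φ` on `(-∞, t₀]`. -/
def IsSolution {m : ℕ} (a : ℝ → ℝ) (b h : Fin m → ℝ → ℝ) (K : Fin m → ℝ → ℝ → ℝ)
    (t₀ : ℝ) (φ x : ℝ → ℝ) : Prop :=
  (∀ T, t₀ ≤ T → AbsolutelyContinuousOnInterval x t₀ T) ∧
    (∀ᵐ t ∂(volume.restrict (Ici t₀)), ∃ x' : ℝ, HasDerivAt x x' t ∧
      x' + a t * x t + ∑ l, b l t * ∫ s in (h l t)..t, K l t s * x s = 0) ∧
    ∀ t, t ≤ t₀ → x t = φ t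

/-- Exponential stability of the integro-differential equation: the solutions of all initial value
problems with initial point `t₀ ≥ 0` and a bounded Borel initial function `φ` satisfy
`|x t| ≤ M ‖φ‖ exp (-α (t - t₀))` for `t ≥ t₀`, where `‖φ‖` is the sup-norm over `(-∞, t₀]` and
`M, α > 0` depend neither on `φ` nor on `t₀`. -/
def ExponentiallyStable {m : ℕ} (a : ℝ → ℝ) (b h : Fin m → ℝ → ℝ)
    (K : Fin m → ℝ → ℝ → ℝ) : Prop :=
  ∃ M > 0, ∃ α > 0, ∀ t₀ : ℝ, 0 ≤ t₀ → ∀ φ x : ℝ → ℝ, IsInitialFunction t₀ φ →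
    IsSolution a b h K t₀ φ x → ∀ t, t₀ ≤ t →
      |x t| ≤ M * (⨆ s : Iic t₀, |φ s|) * Real.exp (-α * (t - t₀))

/-- The function `t ↦ ∫_{min_l h_l(t)}^t a(s) ds`. -/
def delayIntegral {m : ℕ} (a : ℝ → ℝ) (h : Fin m → ℝ → ℝ) (t : ℝ) : ℝ :=
  ∫ s in (⨅ l, h l t)..t, a s

/-- `h₀ = limsup_{t → ∞} ∫_{min_l h_l(t)}^t a(s) ds`. This is the true upper limit when the
function is bounded above near infinity. -/
def limsupDelay {m : ℕ} (a : ℝ → ℝ) (h : Fin m → ℝ → ℝ) : ℝ :=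
  limsup (delayIntegral a h) atTop

/-- `β = limsup_{t → ∞} (∑ l, b_l(t)) / a(t)`. As `a` and the `b_l` are given up to null sets, the
upper limit is the essential one: `atTop ⊓ ae volume` is the filter of the sets that contain almost
every point of some half-line `[T, ∞)`. -/
def limsupRatio {m : ℕ} (a : ℝ → ℝ) (b : Fin m → ℝ → ℝ) : ℝ :=
  limsup (fun t => (∑ l, b l t) / a t) (atTop ⊓ ae volume)

end

/-! Measured by the clock `A`, a primitive of `a`, the equation is decay at unit rate, perturbed by
a memory that eventually has length at most `H`, slightly above `h₀`, and total weight at most `β`,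
slightly above its upper limit. Since `A` grows at least at the rate `a₀`, it suffices to bound `z =
exp (α A) x` for one small `α > 0`. The strict inequality of the criterion leaves room for this
weight (`exists_yorkeCondition`).

The bound is a maximum principle of Yorke type (`YorkeAbove.no_positive_max`). Suppose that `|z|`
has the maximum `S = z t > 0` over the past of a late time `t`, and let `ξ` be the last zero of `z`
before `t`. Once the clock `B = (1 - α) A` has run for `H` after `ξ`, the memory contains only
values `z ≥ 0` and `exp B * z` cannot increase; so `t` lies within `H` of `ξ`. Backwards from `ξ`,
the crude bound `S` on the memory yields `-z s ≤ β S (exp (B ξ - B s) - 1)`. Just after `ξ` the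
memory is estimated by `S`, later by this finer bound. Integrating both pieces up to `t` contradicts
`YorkeCondition.exp_bounds`.

Hence `|z|` never exceeds its bound over an initial period (`abs_le_of_yorke`), where growth is
controlled uniformly in `t₀` by `IsSolution.abs_le_exp`. -/

/-! ### Differential inequalities along a clock -/

/-- An absolutely continuous function whose derivative is almost everywhere nonpositive does not
increase. -/
theorem AbsolutelyContinuousOnInterval.le_of_ae_deriv_nonpos {f : ℝ → ℝ} {p q : ℝ} (hpq : p ≤ q)
    (hf : AbsolutelyContinuousOnInterval f p q)
    (hd : ∀ᵐ t, t ∈ Icc p q → ∃ f' ≤ 0, HasDerivAt f f' t) : f q ≤ f p := by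
  have h1 := hf.integral_deriv_eq_sub
  have h2 : ∫ t in p..q, deriv f t ≤ 0 := by
    rw [intervalIntegral.integral_of_le hpq]
    apply integral_nonpos_of_ae
    refine (ae_restrict_iff' measurableSet_Ioc).2 ?_
    filter_upwards [hd] with t ht hmem
    obtain ⟨f', h0, h'⟩ := ht (Ioc_subset_Icc_self hmem)
    simpa [h'.deriv] using h0
  linarith

/-- A clock: a Lipschitz function on the line that increases at least at the rate `c₀` and has the
derivative `c` almost everywhere. -/
structure IsClock (B c : ℝ → ℝ) (c₀ : ℝ) : Prop where
  rate_le : ∀ s t, s ≤ t → c₀ * (t - s) ≤ B t - B s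
  lipschitz : ∃ L, LipschitzWith L B
  hasDerivAt : ∀ᵐ t, HasDerivAt B (c t) t

namespace IsClock

variable {B c : ℝ → ℝ} {c₀ : ℝ}

theorem continuous (hB : IsClock B c c₀) : Continuous B :=
  hB.lipschitz.choose_spec.continuous

theorem mono (hB : IsClock B c c₀) (hc : 0 < c₀) {s t : ℝ} (h : s ≤ t) : B s ≤ B t := by
  have := hB.rate_le s t h
  have : 0 ≤ c₀ * (t - s) := mul_nonneg hc.le (by linarith)
  linarith

theorem le_of_le (hB : IsClock B c c₀) (hc : 0 < c₀) {s t : ℝ} (h : B s ≤ B t) : s ≤ t := by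
  by_contra! hlt
  have := hB.rate_le t s hlt.le
  have : 0 < c₀ * (s - t) := mul_pos hc (by linarith)
  linarith

theorem absolutelyContinuousOnInterval (hB : IsClock B c c₀) (p q : ℝ) :
    AbsolutelyContinuousOnInterval B p q :=
  (hB.lipschitz.choose_spec.lipschitzOnWith).absolutelyContinuousOnInterval

theorem absolutelyContinuousOnInterval_exp (hB : IsClock B c c₀) (hc : 0 < c₀) (k : ℝ) {p q : ℝ}
    (hpq : p ≤ q) :
    AbsolutelyContinuousOnInterval (fun t => Real.exp (k * B t)) p q := by
  obtain ⟨L, hL⟩ := hB.lipschitz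
  have hE : ContDiffOn ℝ 1 (fun v => Real.exp (k * v)) (Icc (B p) (B q)) := by fun_prop
  obtain ⟨M, hM⟩ := hE.exists_lipschitzOnWith (by decide) (convex_Icc _ _) isCompact_Icc
  have := hM.comp (hL.lipschitzOnWith (s := uIcc p q)) (fun t ht => by
    rw [uIcc_of_le hpq] at ht
    exact ⟨hB.mono hc ht.1, hB.mono hc ht.2⟩)
  exact this.absolutelyContinuousOnInterval

/-- Integration of the inequality `z' + c z ≤ c (C + D exp (-B))`. -/
theorem comparison (hB : IsClock B c c₀) (hc : 0 < c₀) {z : ℝ → ℝ} {p q C D : ℝ} (hpq : p ≤ q)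
    (hz : AbsolutelyContinuousOnInterval z p q)
    (hd : ∀ᵐ t, t ∈ Icc p q → ∃ z', HasDerivAt z z' t ∧
      z' + c t * z t ≤ c t * (C + D * Real.exp (-B t))) :
    Real.exp (B q) * z q - Real.exp (B p) * z p ≤
      C * (Real.exp (B q) - Real.exp (B p)) + D * (B q - B p) := by
  have hE : AbsolutelyContinuousOnInterval (fun t => Real.exp (B t)) p q := by
    simpa using hB.absolutelyContinuousOnInterval_exp hc 1 hpq
  -- The integrating factor `exp B` turns the forcing `c D exp (-B)` into `c D`, with primitive `D
  -- B`.
  have hF : AbsolutelyContinuousOnInterval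
      (fun t => Real.exp (B t) * z t - C * Real.exp (B t) - D * B t) p q :=
    ((hE.fun_mul hz).fun_sub (hE.const_mul C)).fun_sub
      ((hB.absolutelyContinuousOnInterval p q).const_mul D)
  have := hF.le_of_ae_deriv_nonpos hpq (by
    filter_upwards [hd, hB.hasDerivAt] with t ht hBt hmem
    obtain ⟨z', hz', hle⟩ := ht hmem
    refine ⟨_, ?_, ((hBt.exp.mul hz').sub (hBt.exp.const_mul C)).sub (hBt.const_mul D)⟩
    have h1 := mul_le_mul_of_nonneg_left hle (Real.exp_pos (B t)).le
    have h2 : Real.exp (B t) * Real.exp (-B t) = 1 := by rw [← Real.exp_add]; simp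
    have h3 : Real.exp (B t) * (c t * (C + D * Real.exp (-B t))) =
      c t * C * Real.exp (B t) + c t * D := by
      linear_combination (c t * D) * h2
    rw [h3] at h1
    linarith)
  linarith

end IsClock

/-! ### The scalar inequality behind the criterion -/

/-- The hypothesis on the coefficient `β` and the delay `H` in the criterion. -/
def YorkeCondition (β H : ℝ) : Prop :=
  0 ≤ β ∧ 0 < H ∧
    (β < 1 ∨ Real.log ((β ^ 2 + β) / (β ^ 2 + 1)) < 1 / β * Real.exp (-H))

/-- At clock distance `v` after the zero, the memory bounds `S` and `β S (exp (H - v) - 1)` cross at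
`v = u`, where `(1 + β) exp u = β exp H`. This relation turns the last claim into `β² exp H (1 + r -
u - k) < (β² + 1) exp r` with `k = exp (-H) / β`, and `1 + v ≤ exp v` reduces it to the criterion
`β² + β < (β² + 1) exp k`. Equality at `r = u + k` shows that nothing is lost. When `h1` fails, the
crude bound alone excludes a maximum. -/
theorem YorkeCondition.exp_bounds {β H : ℝ} (hβ : YorkeCondition β H)
    (h1 : 1 ≤ β * (1 - Real.exp (-H))) :
    0 < β ∧ ∃ u, 0 ≤ u ∧ u ≤ H ∧ (∀ r ≤ u, β * (1 - Real.exp (-r)) < 1) ∧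
      ∀ r, β * (Real.exp u - 1) +
        β ^ 2 * (Real.exp H * (r - u) - Real.exp r + Real.exp u) < Real.exp r := by
  obtain ⟨h0, hH, hlt⟩ := hβ
  have hE := Real.exp_pos (-H)
  have hEE : Real.exp H * Real.exp (-H) = 1 := by rw [← Real.exp_add]; simp
  have hβ1' : 1 ≤ β := by nlinarith
  have hβ1 : 1 < β := by nlinarith
  have hβ0 : 0 < β := by linarith
  have hlog : Real.log ((β ^ 2 + β) / (β ^ 2 + 1)) < 1 / β * Real.exp (-H) :=
    hlt.resolve_left (by linarith)
  set k := 1 / β * Real.exp (-H) with hk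
  have hkβ : β * k = Real.exp (-H) := by rw [hk]; field_simp
  have hkey : β ^ 2 + β < (β ^ 2 + 1) * Real.exp k := by
    rw [Real.log_lt_iff_lt_exp (by positivity), div_lt_iff₀ (by positivity)] at hlog
    linarith
  have hkey' : (β ^ 2 + β) * Real.exp (-k) < β ^ 2 + 1 := by
    have : Real.exp k * Real.exp (-k) = 1 := by rw [← Real.exp_add]; simp
    have := mul_lt_mul_of_pos_right hkey (Real.exp_pos (-k))
    nlinarith
  have hpos : 0 < 1 + 1 / β := by positivity
  set u := H - Real.log (1 + 1 / β) with hu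
  have heu : (1 + β) * Real.exp u = β * Real.exp H := by
    rw [hu, Real.exp_sub, Real.exp_log hpos]; field_simp; ring
  have hu0 : 0 ≤ u := by
    have : 1 + 1 / β ≤ Real.exp H := by
      have : 1 / β ≤ 1 - Real.exp (-H) := by rw [div_le_iff₀ hβ0]; linarith
      nlinarith [Real.add_one_le_exp H, Real.exp_pos H, sq_nonneg (Real.exp H - 1)]
    have := (Real.log_le_iff_le_exp hpos).2 this
    linarith
  have huH : u ≤ H := by
    have : 0 ≤ Real.log (1 + 1 / β) := Real.log_nonneg (by
      have : 0 < 1 / β := by positivity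
      linarith)
    linarith
  refine ⟨hβ0, u, hu0, huH, fun r hr => ?_, fun r => ?_⟩
  · have h2 : Real.exp (-u) ≤ Real.exp (-r) := Real.exp_le_exp.2 (by linarith)
    have h3 : β * Real.exp (-u) = (1 + β) * Real.exp (-H) := by
      have e1 : Real.exp u * Real.exp (-u) = 1 := by rw [← Real.exp_add]; simp
      linear_combination (1 + β) * Real.exp (-H) * e1 - Real.exp (-u) * Real.exp (-H) * heu
        - β * Real.exp (-u) * hEE
    -- The tangent bound `1 - k ≤ exp (-k)` in the criterion.
    have h4 : β - 1 < (1 + β) * Real.exp (-H) := by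
      have := Real.add_one_le_exp (-k)
      have : (β ^ 2 + β) * (-k + 1) ≤ (β ^ 2 + β) * Real.exp (-k) := by gcongr
      have : (β ^ 2 + β) * k = (1 + β) * Real.exp (-H) := by rw [← hkβ]; ring
      nlinarith
    nlinarith
  · set v := r - u - k with hv
    have h2 : β ^ 2 * Real.exp H * k = β := by
      linear_combination β * Real.exp H * hkβ + β * hEE
    have h3 : 1 + v ≤ Real.exp v := by linarith [Real.add_one_le_exp v]
    have h4 : β ^ 2 * Real.exp H * (1 + v) ≤ β ^ 2 * Real.exp H * Real.exp v := by gcongr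
    have h5 : Real.exp u * Real.exp v = Real.exp r * Real.exp (-k) := by
      rw [← Real.exp_add, ← Real.exp_add]; congr 1; rw [hv]; ring
    have h6 := mul_lt_mul_of_pos_left hkey' (Real.exp_pos r)
    have h7 : β ^ 2 * Real.exp H * Real.exp v =
        Real.exp r * ((β ^ 2 + β) * Real.exp (-k)) := by
      linear_combination -β * Real.exp v * heu + (β ^ 2 + β) * h5
    have h8 : β ^ 2 * Real.exp H * (1 + v) =
        β ^ 2 * Real.exp H * (1 + (r - u)) - β := by
      rw [hv]; linear_combination -h2
    nlinarith

/-! ### The maximum principle -/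

/-- The one-sided Yorke condition with respect to a clock `B`: the memory at time `t` is the set of
the `s ≤ t` with `B t - B s ≤ H`. -/
def YorkeAbove (B c : ℝ → ℝ) (β H t₁ : ℝ) (z : ℝ → ℝ) : Prop :=
  ∀ᵐ t, t₁ ≤ t → ∃ z', HasDerivAt z z' t ∧
    ∀ C, 0 ≤ C → (∀ s ≤ t, B t - B s ≤ H → -z s ≤ C) → z' + c t * z t ≤ c t * (β * C)

/-- The integrated form of the one-sided Yorke condition. -/
theorem YorkeAbove.comparison {B c z : ℝ → ℝ} {c₀ β H t₁ p q C D : ℝ} (hB : IsClock B c c₀)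
    (hc : 0 < c₀) (hz : ∀ T, t₁ ≤ T → AbsolutelyContinuousOnInterval z t₁ T)
    (hY : YorkeAbove B c β H t₁ z) (hp : t₁ ≤ p) (hpq : p ≤ q)
    (G : ℝ → ℝ) (hG0 : ∀ t ∈ Icc p q, 0 ≤ G t)
    (hG : ∀ t ∈ Icc p q, ∀ s ≤ t, B t - B s ≤ H → -z s ≤ G t)
    (hGe : ∀ t, β * G t = C + D * Real.exp (-B t)) :
    Real.exp (B q) * z q - Real.exp (B p) * z p ≤
      C * (Real.exp (B q) - Real.exp (B p)) + D * (B q - B p) := by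
  refine hB.comparison hc hpq ((hz q (hp.trans hpq)).mono ?_) ?_
  · rw [uIcc_of_le hpq, uIcc_of_le (hp.trans hpq)]
    exact Icc_subset_Icc hp le_rfl
  · filter_upwards [hY] with t ht hmem
    obtain ⟨z', hz', hle⟩ := ht (hp.trans hmem.1)
    -- The exceptional null set does not depend on `C`, so `C` may be the time-dependent bound `G
    -- t`.
    exact ⟨z', hz', by rw [← hGe]; exact hle _ (hG0 t hmem) (hG t hmem)⟩

/-- Under the Yorke condition, `|z|` has no positive maximum over the past at a time at which
`z > 0` and the clock has run for more than `2 H`. -/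
theorem YorkeAbove.no_positive_max {B c z : ℝ → ℝ} {c₀ β H t₁ : ℝ} (hB : IsClock B c c₀)
    (hc : 0 < c₀) (hβ : YorkeCondition β H)
    (hz : ∀ T, t₁ ≤ T → AbsolutelyContinuousOnInterval z t₁ T)
    (hY : YorkeAbove B c β H t₁ z) {t : ℝ} (htB : B t₁ + 2 * H < B t)
    (hpos : 0 < z t) (hmax : ∀ s ≤ t, |z s| ≤ z t) : False := by
  have hH := hβ.2.1
  have hβ0 := hβ.1
  have ht1 : t₁ ≤ t := hB.le_of_le hc (by linarith)
  have hcont : ContinuousOn z (Icc t₁ t) := by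
    have := (hz t ht1).continuousOn
    rwa [uIcc_of_le ht1] at this
  set S := z t with hS
  -- On a longer nonnegative stretch the memory from `τ` on stays inside the stretch, so `exp B * z`
  -- does not increase from `τ` to `t`. Then `z t < S`, which is absurd.
  have hclaim : ∀ ξ ∈ Icc t₁ t, (∀ s ∈ Icc ξ t, 0 ≤ z s) → B t - B ξ ≤ H := by
    intro ξ hξ hnn
    by_contra! hlt
    obtain ⟨τ, hτ, hτB⟩ : B ξ + H ∈ B '' Icc ξ t :=
      intermediate_value_Icc hξ.2 hB.continuous.continuousOn ⟨by linarith, by linarith⟩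
    have := hY.comparison (C := 0) (D := 0) hB hc hz (hξ.1.trans hτ.1) hτ.2 (fun _ => 0)
      (fun _ _ => le_rfl) (fun r hr s hs hsB => by
        have h1 := hB.mono hc hr.1
        have h2 : ξ ≤ s := hB.le_of_le hc (by linarith)
        have := hnn s ⟨h2, hs.trans hr.2⟩
        linarith) (fun _ => by simp)
    have h3 : z τ ≤ S := (le_abs_self _).trans (hmax τ hτ.2)
    have h4 : Real.exp (B τ) < Real.exp (B t) := Real.exp_lt_exp.2 (by linarith)
    have h5 : Real.exp (B τ) * z τ ≤ Real.exp (B τ) * S := by gcongr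
    have h6 : Real.exp (B τ) * S < Real.exp (B t) * S := by gcongr
    linarith
  obtain ⟨ξ, ⟨⟨hξm, hξ0⟩, hξmax⟩⟩ : ∃ ξ, IsGreatest (Icc t₁ t ∩ z ⁻¹' Iic 0) ξ := by
    refine IsCompact.exists_isGreatest ?_ ?_
    · exact isCompact_Icc.of_isClosed_subset (hcont.preimage_isClosed_of_isClosed isClosed_Icc
        isClosed_Iic) inter_subset_left
    · by_contra hne
      rw [not_nonempty_iff_eq_empty] at hne
      have := hclaim t₁ ⟨le_rfl, ht1⟩ (fun s hs => by
        by_contra! hneg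
        have : s ∈ Icc t₁ t ∩ z ⁻¹' Iic 0 := ⟨hs, hneg.le⟩
        rw [hne] at this
        exact this)
      linarith
  have hξz : z ξ = 0 := by
    obtain ⟨η, hη, hη0⟩ : (0 : ℝ) ∈ z '' Icc ξ t :=
      intermediate_value_Icc hξm.2 (hcont.mono (Icc_subset_Icc hξm.1 le_rfl)) ⟨hξ0, hpos.le⟩
    have : η ≤ ξ := hξmax ⟨⟨hξm.1.trans hη.1, hη.2⟩, hη0.le⟩
    rwa [le_antisymm this hη.1] at hη0
  have hnn : ∀ s ∈ Icc ξ t, 0 ≤ z s := by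
    intro s hs
    by_contra! hneg
    have : s ≤ ξ := hξmax ⟨⟨hξm.1.trans hs.1, hs.2⟩, hneg.le⟩
    rw [le_antisymm this hs.1] at hneg
    linarith
  have hrH := hclaim ξ hξm hnn
  have hr0 := hB.mono hc hξm.2
  have hconst : ∀ p q, t₁ ≤ p → p ≤ q → q ≤ t →
      Real.exp (B q) * z q - Real.exp (B p) * z p ≤
        β * S * (Real.exp (B q) - Real.exp (B p)) := by
    intro p q hp hpq hq
    have := hY.comparison (C := β * S) (D := 0) hB hc hz hp hpq (fun _ => S)
      (fun _ _ => hpos.le) (fun r hr s hs _ =>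
        (neg_le_abs _).trans (hmax s (hs.trans (hr.2.trans hq)))) (fun _ => by simp)
    simpa using this
  have hexp : ∀ x y, Real.exp (x - y) * Real.exp y = Real.exp x := fun x y => by
    rw [← Real.exp_add]; simp
  have hcoarse : 1 ≤ β * (1 - Real.exp (-(B t - B ξ))) := by
    have h1 := hconst ξ t hξm.1 hξm.2 le_rfl
    rw [hξz, mul_zero, sub_zero] at h1
    have h2 : Real.exp (B ξ) = Real.exp (-(B t - B ξ)) * Real.exp (B t) := by
      rw [← hexp (B ξ) (B t)]; congr 2; ring
    rw [h2] at h1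
    have h3 : 0 < Real.exp (B t) * S := mul_pos (Real.exp_pos _) hpos
    refine le_of_mul_le_mul_right ?_ h3
    linarith
  have h1H : 1 ≤ β * (1 - Real.exp (-H)) :=
    hcoarse.trans (by gcongr)
  obtain ⟨hβpos, u, hu0, huH, hsmall, hlarge⟩ := hβ.exp_bounds h1H
  have hur : u < B t - B ξ := by
    by_contra! hle
    linarith [hsmall _ hle]
  obtain ⟨p, hp, hpB⟩ : B ξ + u ∈ B '' Icc ξ t :=
    intermediate_value_Icc hξm.2 hB.continuous.continuousOn ⟨by linarith, by linarith⟩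
  have hpast : ∀ s, t₁ ≤ s → s ≤ ξ → -z s ≤ β * S * (Real.exp (B ξ - B s) - 1) := by
    intro s hs hsξ
    have h1 := hconst s ξ hs hsξ hξm.2
    rw [hξz, mul_zero, zero_sub, ← hexp (B ξ) (B s)] at h1
    refine le_of_mul_le_mul_right ?_ (Real.exp_pos (B s))
    linarith
  -- Memory after `ξ` contributes only `z ≥ 0`; memory before `ξ` falls under `hpast`. It reaches
  -- back at most `2 H` from `t`, hence not beyond `t₁`.
  have hfine := hY.comparison (C := -(β ^ 2 * S)) (D := β ^ 2 * S * Real.exp (H + B ξ)) hB hc hz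
    (hξm.1.trans hp.1) hp.2 (fun r => β * S * (Real.exp (H + B ξ - B r) - 1))
    (fun r hr => by
      have := hB.mono hc hr.2
      have : 1 ≤ Real.exp (H + B ξ - B r) := Real.one_le_exp (by linarith)
      exact mul_nonneg (mul_nonneg hβ0 hpos.le) (by linarith))
    (fun r hr s hs hsB => by
      have h1 := hB.mono hc hr.2
      have h2 := hB.mono hc (hp.1.trans hr.1)
      rcases le_total ξ s with h | h
      · have h3 : 1 ≤ Real.exp (H + B ξ - B r) := Real.one_le_exp (by linarith)
        have h4 : 0 ≤ β * S * (Real.exp (H + B ξ - B r) - 1) :=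
          mul_nonneg (mul_nonneg hβ0 hpos.le) (by linarith)
        linarith [hnn s ⟨h, hs.trans hr.2⟩]
      · refine (hpast s (hB.le_of_le hc (by linarith)) h).trans ?_
        have h3 : Real.exp (B ξ - B s) ≤ Real.exp (H + B ξ - B r) :=
          Real.exp_le_exp.2 (by linarith)
        have := mul_nonneg hβ0 hpos.le
        gcongr)
    (fun r => by
      rw [sub_eq_add_neg (H + B ξ), Real.exp_add (H + B ξ)]; ring)
  have hfirst := hconst ξ p hξm.1 hp.1 hp.2
  rw [hξz, mul_zero, sub_zero] at hfirst
  have hL := hlarge (B t - B ξ)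
  have hEp : Real.exp (B p) = Real.exp u * Real.exp (B ξ) := by
    rw [hpB, add_comm, Real.exp_add]
  have hEt : Real.exp (B t) = Real.exp (B t - B ξ) * Real.exp (B ξ) := (hexp _ _).symm
  rw [Real.exp_add, hpB] at hfine
  rw [← hpB, hEp] at hfine
  rw [hEp] at hfirst
  rw [hEt] at hfine
  have hmul := mul_lt_mul_of_pos_right hL (mul_pos (Real.exp_pos (B ξ)) hpos)
  rw [← hS, hpB] at hfine
  nlinarith

/-- A function that satisfies the Yorke condition from above and from below is bounded by its
bound up to the time at which the clock has run for `2 H`. -/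
theorem abs_le_of_yorke {B c z : ℝ → ℝ} {c₀ β H t₁ t₂ N : ℝ} (hB : IsClock B c c₀)
    (hc : 0 < c₀) (hβ : YorkeCondition β H)
    (hz : ∀ T, t₁ ≤ T → AbsolutelyContinuousOnInterval z t₁ T)
    (hY : YorkeAbove B c β H t₁ z) (hY' : YorkeAbove B c β H t₁ (fun s => -z s))
    (ht : B t₁ + 2 * H ≤ B t₂) (hN : ∀ s ≤ t₂, |z s| ≤ N) (t : ℝ) : |z t| ≤ N := by
  by_contra! hlt
  have htt : t₂ < t := by
    by_contra! h
    linarith [hN t h]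
  have h12 : t₁ ≤ t₂ := hB.le_of_le hc (by linarith [hβ.2.1])
  have hcont : ContinuousOn (fun s => |z s|) (Icc t₂ t) := by
    have := (hz t (h12.trans htt.le)).continuousOn
    rw [uIcc_of_le (h12.trans htt.le)] at this
    exact (this.mono (Icc_subset_Icc h12 le_rfl)).abs
  obtain ⟨τ, hτ, hτmax⟩ := isCompact_Icc.exists_isMaxOn (nonempty_Icc.2 htt.le) hcont
  have hτN : N < |z τ| := hlt.trans_le (hτmax ⟨htt.le, le_rfl⟩)
  -- A maximum above `N` on `[t₂, t]` is a maximum over the whole past.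
  have hmax : ∀ s ≤ τ, |z s| ≤ |z τ| := by
    intro s hs
    rcases le_total s t₂ with h | h
    · exact (hN s h).trans hτN.le
    · exact hτmax ⟨h, hs.trans hτ.2⟩
  have h2τ : t₂ < τ := by
    by_contra! h
    linarith [hN τ h]
  have hBτ : B t₁ + 2 * H < B τ := by
    have := hB.rate_le t₂ τ h2τ.le
    have : 0 < c₀ * (τ - t₂) := mul_pos hc (by linarith)
    linarith
  have hne : 0 < |z τ| := ((abs_nonneg _).trans (hN t₂ le_rfl)).trans_lt hτN
  rcases le_total 0 (z τ) with h | h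
  · rw [abs_of_nonneg h] at hne hmax
    exact hY.no_positive_max hB hc hβ hz hBτ hne hmax
  · rw [abs_of_nonpos h] at hne hmax
    exact hY'.no_positive_max hB hc hβ (fun T hT => (hz T hT).fun_neg) hBτ hne
      (fun s hs => by simpa using hmax s hs)

/-! ### Room for the exponential weight -/

/-- The strict inequality of the criterion leaves room for an exponential weight. -/
theorem exists_yorkeCondition {β₀ h₀ : ℝ} (hh₀ : 0 ≤ h₀)
    (h : β₀ = 0 ∨
      Real.log ((β₀ ^ 2 + β₀) / (β₀ ^ 2 + 1)) < 1 / β₀ * Real.exp (-h₀)) :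
    ∃ β H α γ : ℝ, β₀ < β ∧ h₀ < H ∧ 0 < α ∧ α < 1 ∧
      β * Real.exp (α * H) ≤ (1 - α) * γ ∧ YorkeCondition γ H := by
  -- The sign of `β₀` is not assumed. One parameter `ε` serves as the weight `α` and as the excess
  -- of `β` and `H`; `γ ε` is the resulting coefficient, continuous at `0` with value `m`.
  set m := max β₀ 0 with hm
  let γ : ℝ → ℝ := fun ε => (m + ε) * Real.exp (ε * (h₀ + ε)) / (1 - ε)
  have hγ : ContinuousAt γ 0 := by
    refine ContinuousAt.div (by fun_prop) (by fun_prop) (by norm_num)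
  have hγ0 : γ 0 = m := by simp [γ]
  have hev : ∀ᶠ ε in nhds (0 : ℝ), γ ε < 1 ∨
      Real.log ((γ ε ^ 2 + γ ε) / (γ ε ^ 2 + 1)) < 1 / γ ε * Real.exp (-(h₀ + ε)) := by
    rcases lt_or_ge m 1 with h1 | h1
    · exact (hγ.eventually_lt_const (by rwa [hγ0])).mono fun _ => Or.inl
    · have hmβ : m = β₀ := by
        rcases max_choice β₀ 0 with h' | h'
        · exact h'
        · rw [← hm] at h'; linarith
      have h2 := h.resolve_left (by rw [← hmβ]; linarith)
      refine Eventually.mono (ContinuousAt.eventually_lt (f := fun ε =>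
        Real.log ((γ ε ^ 2 + γ ε) / (γ ε ^ 2 + 1))) (g := fun ε =>
        1 / γ ε * Real.exp (-(h₀ + ε))) ?_ ?_ ?_) fun _ => Or.inr
      · refine ContinuousAt.log (ContinuousAt.div (by fun_prop) (by fun_prop) ?_) ?_ <;>
          rw [hγ0] <;> positivity
      · refine (ContinuousAt.div (by fun_prop) hγ ?_).mul (by fun_prop)
        rw [hγ0]; positivity
      · simpa [hγ0, hmβ] using h2
  obtain ⟨ε, hε, hε0, hε1⟩ := ((hev.filter_mono nhdsWithin_le_nhds).and
    (Ioo_mem_nhdsGT (zero_lt_one' ℝ))).exists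
  have hm0 : 0 ≤ m := le_max_right _ _
  have hmβ : β₀ ≤ m := le_max_left _ _
  refine ⟨m + ε, h₀ + ε, ε, γ ε, by linarith, by linarith, hε0, hε1, ?_, ?_, by linarith, hε⟩
  · have : 1 - ε ≠ 0 := by linarith
    simp only [γ]
    rw [mul_div_cancel₀ _ this]
  · exact div_nonneg (mul_nonneg (by linarith) (Real.exp_pos _).le) (by linarith)

/-! ### The clock of the equation and its delayed terms -/

/-- The primitive of a measurable function with values between two constants is a clock. -/
theorem isClock_integral {c : ℝ → ℝ} {c₀ c₁ : ℝ} (hm : AEStronglyMeasurable c volume)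
    (h0 : 0 < c₀) (hlow : ∀ᵐ t, c₀ ≤ c t) (hup : ∀ᵐ t, c t ≤ c₁) :
    IsClock (fun t => ∫ s in (0 : ℝ)..t, c s) c c₀ ∧ ∀ p q, IntervalIntegrable c volume p q := by
  have hbd : ∀ᵐ t, ‖c t‖ ≤ c₁ := by
    filter_upwards [hlow, hup] with t h1 h2
    rw [Real.norm_of_nonneg (by linarith)]
    exact h2
  have hloc : LocallyIntegrable c volume := by
    refine (locallyIntegrable_const c₁).mono hm ?_
    filter_upwards [hbd] with t ht using ht.trans (le_abs_self _)
  have hint : ∀ p q, IntervalIntegrable c volume p q := fun p q =>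
    (hloc.integrableOn_isCompact isCompact_uIcc).intervalIntegrable
  refine ⟨⟨fun s t hst => ?_, ⟨c₁.toNNReal, ?_⟩, ?_⟩, hint⟩
  · rw [intervalIntegral.integral_interval_sub_left (hint _ _) (hint _ _)]
    have : ∫ _ in s..t, c₀ ≤ ∫ r in s..t, c r :=
      intervalIntegral.integral_mono_ae hst intervalIntegrable_const (hint _ _) hlow
    simpa [mul_comm] using this
  · refine LipschitzWith.of_dist_le_mul fun t s => ?_
    rw [Real.dist_eq, Real.dist_eq,
      intervalIntegral.integral_interval_sub_left (hint _ _) (hint _ _)]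
    refine (intervalIntegral.norm_integral_le_of_norm_le_const_ae
      (hbd.mono fun _ h _ => h)).trans ?_
    gcongr
    exact Real.le_coe_toNNReal _
  · filter_upwards [LocallyIntegrable.ae_hasDerivAt_integral hloc] with t ht using ht 0

theorem IsClock.const_mul {B c : ℝ → ℝ} {c₀ k : ℝ} (hB : IsClock B c c₀) (hk : 0 ≤ k) :
    IsClock (fun t => k * B t) (fun t => k * c t) (k * c₀) := by
  refine ⟨fun s t hst => ?_, ?_, ?_⟩
  · have := mul_le_mul_of_nonneg_left (hB.rate_le s t hst) hk
    linarith
  · obtain ⟨L, hL⟩ := hB.lipschitz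
    exact ⟨‖k‖₊ * L, (lipschitzWith_smul k).comp hL⟩
  · filter_upwards [hB.hasDerivAt] with t ht using ht.const_mul k

/-- Averaging against a unit kernel preserves lower bounds `-C` with `C ≥ 0`. -/
theorem IsUnitKernel.neg_integral_le {h : ℝ → ℝ} {K : ℝ → ℝ → ℝ} (hh : ∀ t, 0 ≤ t → h t ≤ t)
    (hK : IsUnitKernel h K) :
    ∀ᵐ t, 0 ≤ t → ∀ (y : ℝ → ℝ) (C : ℝ), 0 ≤ C → (∀ s ∈ Icc (h t) t, -y s ≤ C) →
      -∫ s in (h t)..t, K t s * y s ≤ C := by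
  obtain ⟨-, hpos, -, hone⟩ := hK
  have hpos' := Measure.ae_ae_of_ae_prod
    (by simpa [Measure.volume_eq_prod] using ae_imp_of_ae_restrict hpos :
      ∀ᵐ p ∂((volume : Measure ℝ).prod (volume : Measure ℝ)),
        p ∈ kernelDomain h → 0 ≤ K p.1 p.2)
  filter_upwards [hpos', ae_imp_of_ae_restrict hone] with t ht h1 ht0 y C hC hy
  have hone := h1 ht0
  -- A nonintegrable kernel would have the integral `0`, not `1`.
  have hint : IntervalIntegrable (K t) volume (h t) t := by
    by_contra hni
    rw [intervalIntegral.integral_undef hni] at hone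
    exact zero_ne_one hone
  by_cases hKy : IntervalIntegrable (fun s => K t s * y s) volume (h t) t
  · have : ∫ s in (h t)..t, -C * K t s ≤ ∫ s in (h t)..t, K t s * y s := by
      refine intervalIntegral.integral_mono_ae_restrict (hh t ht0) (hint.const_mul _) hKy ?_
      refine (ae_restrict_iff' measurableSet_Icc).2 ?_
      filter_upwards [ht] with s hs hmem
      have h2 : 0 ≤ K t s := hs ⟨ht0, hmem.1, hmem.2⟩
      have h3 := mul_le_mul_of_nonneg_left (hy s hmem) h2
      linarith
    rw [intervalIntegral.integral_const_mul, hone] at this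
    linarith
  -- Here the integral has the default value `0`, and `C ≥ 0` is what is needed.
  · rw [intervalIntegral.integral_undef hKy]
    simpa using hC

/-- A lower bound for the delayed terms of the equation. -/
theorem neg_sum_integral_le {m : ℕ} {b h : Fin m → ℝ → ℝ} {K : Fin m → ℝ → ℝ → ℝ}
    (hb : ∀ l, ∀ᵐ t ∂(volume.restrict (Ici 0)), 0 ≤ b l t)
    (hh : ∀ l, IsDelay (h l)) (hK : ∀ l, IsUnitKernel (h l) (K l)) :
    ∀ᵐ t, 0 ≤ t → ∀ (y : ℝ → ℝ) (C : ℝ), 0 ≤ C →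
      (∀ l, ∀ s ∈ Icc (h l t) t, -y s ≤ C) →
      -(∑ l, b l t * ∫ s in (h l t)..t, K l t s * y s) ≤ (∑ l, b l t) * C := by
  have h1 := ae_all_iff.2 fun l => (hK l).neg_integral_le (hh l).2.1
  have h2 := ae_all_iff.2 fun l => ae_imp_of_ae_restrict (hb l)
  filter_upwards [h1, h2] with t h1 h2 ht y C hC hy
  rw [← Finset.sum_neg_distrib, Finset.sum_mul]
  refine Finset.sum_le_sum fun l _ => ?_
  rw [← mul_neg]
  exact mul_le_mul_of_nonneg_left (h1 l ht y C hC (hy l)) (h2 l ht)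

theorem IsSolution.neg {m : ℕ} {a : ℝ → ℝ} {b h : Fin m → ℝ → ℝ} {K : Fin m → ℝ → ℝ → ℝ}
    {t₀ : ℝ} {φ x : ℝ → ℝ} (hx : IsSolution a b h K t₀ φ x) :
    IsSolution a b h K t₀ (fun s => -φ s) (fun s => -x s) := by
  refine ⟨fun T hT => (hx.1 T hT).fun_neg, ?_, fun t ht => congrArg Neg.neg (hx.2.2 t ht)⟩
  filter_upwards [hx.2.1] with t ⟨x', hx', he⟩
  refine ⟨-x', hx'.neg, ?_⟩
  simp only [mul_neg, intervalIntegral.integral_neg, Finset.sum_neg_distrib]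
  linarith

/-! ### Growth of solutions over bounded times -/

/-- A solution cannot reach a bound that grows at the rate `L`. -/
theorem IsSolution.lt_of_le_exp {m : ℕ} {a : ℝ → ℝ} {b h : Fin m → ℝ → ℝ}
    {K : Fin m → ℝ → ℝ → ℝ} {t₀ L S τ : ℝ} {φ x : ℝ → ℝ} (ht₀ : 0 ≤ t₀)
    (hb : ∀ l, ∀ᵐ t ∂(volume.restrict (Ici 0)), 0 ≤ b l t)
    (hh : ∀ l, IsDelay (h l)) (hK : ∀ l, IsUnitKernel (h l) (K l))
    (hLab : ∀ᵐ t, 0 ≤ t → |a t| + ∑ l, b l t ≤ L)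
    (hx : IsSolution a b h K t₀ φ x) (hτ : t₀ ≤ τ) (h0 : x t₀ < S) (hS : 0 ≤ S)
    (hle : ∀ t ∈ Icc t₀ τ, ∀ s ≤ t, |x s| ≤ S * Real.exp (L * (t - t₀))) :
    x τ < S * Real.exp (L * (τ - t₀)) := by
  have hexp : AbsolutelyContinuousOnInterval (fun t => S * Real.exp (L * (t - t₀))) t₀ τ :=
    ContDiffOn.absolutelyContinuousOnInterval (by fun_prop)
  have := ((hx.1 τ hτ).fun_sub hexp).le_of_ae_deriv_nonpos hτ (by
    filter_upwards [ae_imp_of_ae_restrict hx.2.1, neg_sum_integral_le hb hh hK, hLab]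
      with t h1 h2 h3 hmem
    obtain ⟨x', hx', he⟩ := h1 hmem.1
    have ht0 := ht₀.trans hmem.1
    have hE : HasDerivAt (fun t => S * Real.exp (L * (t - t₀)))
        (S * (Real.exp (L * (t - t₀)) * (L * 1))) t :=
      ((((hasDerivAt_id t).sub_const t₀).const_mul L).exp).const_mul S
    refine ⟨_, ?_, hx'.sub hE⟩
    set C := S * Real.exp (L * (t - t₀)) with hC
    have hC0 : 0 ≤ C := mul_nonneg hS (Real.exp_pos _).le
    have h4 := h2 ht0 x C hC0 (fun l s hs => (neg_le_abs _).trans (hle t hmem s hs.2))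
    have h5 : -(a t * x t) ≤ |a t| * C := by
      refine (neg_le_abs _).trans ?_
      rw [abs_mul]
      exact mul_le_mul_of_nonneg_left (hle t hmem t le_rfl) (abs_nonneg _)
    have h6 := mul_le_mul_of_nonneg_right (h3 ht0) hC0
    have h7 : S * (Real.exp (L * (t - t₀)) * (L * 1)) = L * C := by rw [hC]; ring
    rw [h7]
    linarith)
  simp only [sub_self, mul_zero, Real.exp_zero, mul_one] at this
  linarith

/-- Solutions grow at most exponentially. -/
theorem IsSolution.abs_le_exp {m : ℕ} {a : ℝ → ℝ} {b h : Fin m → ℝ → ℝ}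
    {K : Fin m → ℝ → ℝ → ℝ} {t₀ L N : ℝ} {φ x : ℝ → ℝ} (ht₀ : 0 ≤ t₀) (hL : 0 ≤ L)
    (hb : ∀ l, ∀ᵐ t ∂(volume.restrict (Ici 0)), 0 ≤ b l t)
    (hh : ∀ l, IsDelay (h l)) (hK : ∀ l, IsUnitKernel (h l) (K l))
    (hLab : ∀ᵐ t, 0 ≤ t → |a t| + ∑ l, b l t ≤ L)
    (hx : IsSolution a b h K t₀ φ x) (hN : ∀ s ≤ t₀, |x s| ≤ N) {t : ℝ} (ht : t₀ ≤ t) :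
    |x t| ≤ N * Real.exp (L * (t - t₀)) := by
  have hcont : ContinuousOn (fun s => |x s| * Real.exp (-(L * (s - t₀)))) (Icc t₀ t) := by
    have := (hx.1 t ht).continuousOn
    rw [uIcc_of_le ht] at this
    exact this.abs.mul (by fun_prop)
  obtain ⟨τ, hτ, hτmax⟩ := isCompact_Icc.exists_isMaxOn (nonempty_Icc.2 ht) hcont
  set S := |x τ| * Real.exp (-(L * (τ - t₀))) with hS
  have hS0 : 0 ≤ S := by positivity
  have hE : ∀ s, Real.exp (-(L * (s - t₀))) * Real.exp (L * (s - t₀)) = 1 := fun s => by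
    rw [← Real.exp_add]; simp
  have hbound : ∀ s ∈ Icc t₀ t, |x s| ≤ S * Real.exp (L * (s - t₀)) := by
    intro s hs
    have h1 : |x s| * Real.exp (-(L * (s - t₀))) ≤ S := hτmax hs
    have h2 := mul_le_mul_of_nonneg_right h1 (Real.exp_pos (L * (s - t₀))).le
    rwa [mul_assoc, hE, mul_one] at h2
  suffices hSN : S ≤ N from
    (hbound t ⟨ht, le_rfl⟩).trans (by gcongr)
  -- If `S > N`, the weighted maximum `S` dominates the whole past, and the strict bound for `x` and
  -- `-x` makes `|x τ|` smaller than itself.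
  by_contra! hlt
  have hle : ∀ r ∈ Icc t₀ τ, ∀ s ≤ r, |x s| ≤ S * Real.exp (L * (r - t₀)) := by
    intro r hr s hs
    rcases le_total s t₀ with h | h
    · have : 1 ≤ Real.exp (L * (r - t₀)) :=
        Real.one_le_exp (mul_nonneg hL (by linarith [hr.1]))
      nlinarith [hN s h]
    · refine (hbound s ⟨h, hs.trans (hr.2.trans hτ.2)⟩).trans ?_
      gcongr
  have h1 := hx.lt_of_le_exp ht₀ hb hh hK hLab hτ.1
    (((le_abs_self _).trans (hN t₀ le_rfl)).trans_lt hlt) hS0 hle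
  have h2 := hx.neg.lt_of_le_exp ht₀ hb hh hK hLab hτ.1
    (((neg_le_abs _).trans (hN t₀ le_rfl)).trans_lt hlt) hS0 (by simpa using hle)
  have h3 : S * Real.exp (L * (τ - t₀)) = |x τ| := by rw [hS, mul_assoc, hE, mul_one]
  rw [h3] at h1 h2
  rcases abs_choice (x τ) with h | h <;> linarith

/-! ### Decay of the weighted solution -/

/-- A solution with an exponential weight satisfies the Yorke condition. -/
theorem IsSolution.yorkeAbove {m : ℕ} {a A : ℝ → ℝ} {b h : Fin m → ℝ → ℝ}
    {K : Fin m → ℝ → ℝ → ℝ} {t₀ t₁ a₀ α β γ H : ℝ} {φ x : ℝ → ℝ} (ht₀ : 0 ≤ t₀)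
    (ht₁ : t₀ ≤ t₁) (ha₀ : 0 < a₀) {c : ℝ → ℝ} (hA : IsClock A c a₀)
    (hc : ∀ t, 0 ≤ t → c t = a t) (hα : 0 < α)
    (hb : ∀ l, ∀ᵐ t ∂(volume.restrict (Ici 0)), 0 ≤ b l t)
    (hh : ∀ l, IsDelay (h l)) (hK : ∀ l, IsUnitKernel (h l) (K l))
    (hγ : β * Real.exp (α * H) ≤ (1 - α) * γ)
    (hpos : ∀ᵐ t, 0 ≤ t → 0 ≤ a t)
    (hratio : ∀ᵐ t, t₁ ≤ t → ∑ l, b l t ≤ β * a t)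
    (hdelay : ∀ t, t₁ ≤ t → ∀ l, A t - A (h l t) ≤ H)
    (hx : IsSolution a b h K t₀ φ x) :
    YorkeAbove (fun t => (1 - α) * A t) (fun t => (1 - α) * c t) γ H t₁
      (fun t => Real.exp (α * A t) * x t) := by
  filter_upwards [ae_imp_of_ae_restrict hx.2.1, neg_sum_integral_le hb hh hK, hratio, hpos,
    hA.hasDerivAt] with t h1 h2 h3 h4 hAt ht
  obtain ⟨x', hx', he⟩ := h1 (ht₁.trans ht)
  have ht0 := ht₀.trans (ht₁.trans ht)
  refine ⟨_, (hAt.const_mul α).exp.mul hx', fun C hC hz => ?_⟩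
  rw [hc t ht0]
  have hE : ∀ v, Real.exp (-(α * v)) * Real.exp (α * v) = 1 := fun s => by
    rw [← Real.exp_add]; simp
  have h5 := h2 ht0 x (C * (Real.exp (α * H) * Real.exp (-(α * A t)))) (by positivity)
    (fun l s hs => by
      have hs1 := hA.mono ha₀ hs.1
      have hs2 := hA.mono ha₀ hs.2
      have hd := hdelay t ht l
      have h6 : -(Real.exp (α * A s) * x s) ≤ C :=
        -- The clock `(1 - α) A` runs slower than `A`, so its memory of length `H` contains that of
        -- `A`.
        hz s hs.2 (by
          have : 0 ≤ α * (A t - A s) := mul_nonneg hα.le (by linarith)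
          linarith)
      have h7 := mul_le_mul_of_nonneg_left h6 (Real.exp_pos (-(α * A s))).le
      have h8 : Real.exp (-(α * A s)) * -(Real.exp (α * A s) * x s) = -x s := by
        linear_combination -x s * hE (A s)
      rw [h8, mul_comm] at h7
      refine h7.trans ?_
      rw [← Real.exp_add]
      have : -(α * A s) ≤ α * H + -(α * A t) := by
        have := mul_le_mul_of_nonneg_left (show A t - A s ≤ H by linarith) hα.le
        linarith
      gcongr)
  have h6 := mul_le_mul_of_nonneg_left h5 (Real.exp_pos (α * A t)).le
  have h7 : (∑ l, b l t) * (C * Real.exp (α * H)) ≤ β * a t * (C * Real.exp (α * H)) :=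
    mul_le_mul_of_nonneg_right (h3 ht) (by positivity)
  have h8 := mul_le_mul_of_nonneg_right hγ (mul_nonneg (h4 ht0) hC)
  have h9 : Real.exp (α * A t) *
      ((∑ l, b l t) * (C * (Real.exp (α * H) * Real.exp (-(α * A t))))) =
      (∑ l, b l t) * (C * Real.exp (α * H)) := by
    linear_combination (∑ l, b l t) * C * Real.exp (α * H) * hE (A t)
  rw [h9] at h6
  have h10 : Real.exp (α * A t) * (x' + a t * x t) =
      Real.exp (α * A t) * -(∑ l, b l t * ∫ s in (h l t)..t, K l t s * x s) := by
    congr 1; linarith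
  linarith

/-- Exponential decay of the solutions after the time `T` from which on the coefficients and the
delays satisfy the criterion. -/
theorem exponentiallyStable_of_eventually {m : ℕ} {a A c : ℝ → ℝ} {b h : Fin m → ℝ → ℝ}
    {K : Fin m → ℝ → ℝ → ℝ} {T L a₀ α β γ H : ℝ} (hT : 0 ≤ T) (hL : 0 ≤ L) (ha₀ : 0 < a₀)
    (hA : IsClock A c a₀) (hc : ∀ t, 0 ≤ t → c t = a t) (hα : 0 < α) (hα1 : α < 1)
    (hb : ∀ l, ∀ᵐ t ∂(volume.restrict (Ici 0)), 0 ≤ b l t)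
    (hh : ∀ l, IsDelay (h l)) (hK : ∀ l, IsUnitKernel (h l) (K l))
    (hγ : β * Real.exp (α * H) ≤ (1 - α) * γ) (hY : YorkeCondition γ H)
    (hpos : ∀ᵐ t, 0 ≤ t → 0 ≤ a t)
    (hLab : ∀ᵐ t, 0 ≤ t → |a t| + ∑ l, b l t ≤ L)
    (hratio : ∀ᵐ t, T ≤ t → ∑ l, b l t ≤ β * a t)
    (hdelay : ∀ t, T ≤ t → ∀ l, A t - A (h l t) ≤ H) :
    ExponentiallyStable a b h K := by
  have hα' : 0 < 1 - α := by linarith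
  -- Within time `δ` the clock `(1 - α) A` advances by at least `2 H`.
  set δ := 2 * H / ((1 - α) * a₀) with hδ
  have hδ0 : 0 ≤ δ := div_nonneg (by linarith [hY.2.1]) (by positivity)
  -- The first factor is the growth up to `t₂ ≤ t₀ + T + δ`; the second moves the start of the decay
  -- from there back to `t₀`.
  refine ⟨Real.exp (L * (T + δ)) * Real.exp (α * a₀ * (T + δ)), by positivity, α * a₀,
    by positivity, ?_⟩
  intro t₀ ht₀ φ x hφ hx t ht
  obtain ⟨C, hC⟩ := hφ.2
  set N := ⨆ s : Iic t₀, |φ s| with hN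
  have hxN : ∀ s ≤ t₀, |x s| ≤ N := fun s hs => by
    rw [hx.2.2 s hs]
    exact le_ciSup (f := fun s : Iic t₀ => |φ s|)
      ⟨C, by rintro _ ⟨s, rfl⟩; exact hC s s.2⟩ ⟨s, hs⟩
  have hN0 : 0 ≤ N := (abs_nonneg _).trans (hxN t₀ le_rfl)
  set t₁ := max t₀ T with ht₁
  have h01 : t₀ ≤ t₁ := le_max_left _ _
  have hT1 : T ≤ t₁ := le_max_right _ _
  have h1T : t₁ ≤ t₀ + T := max_le (by linarith) (by linarith)
  set t₂ := t₁ + δ with ht₂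
  set N' := N * Real.exp (L * (T + δ)) with hN'
  have hx2 : ∀ s ≤ t₂, |x s| ≤ N' := by
    intro s hs
    rcases le_total s t₀ with h | h
    · have : 1 ≤ Real.exp (L * (T + δ)) := Real.one_le_exp (by positivity)
      exact (hxN s h).trans (le_mul_of_one_le_right hN0 this)
    · refine (hx.abs_le_exp ht₀ hL hb hh hK hLab hxN h).trans ?_
      have : s - t₀ ≤ T + δ := by linarith
      exact mul_le_mul_of_nonneg_left
        (Real.exp_le_exp.2 (mul_le_mul_of_nonneg_left this hL)) hN0
  have hratio' : ∀ᵐ t, t₁ ≤ t → ∑ l, b l t ≤ β * a t := by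
    filter_upwards [hratio] with t h ht using h (hT1.trans ht)
  have hdelay' : ∀ t, t₁ ≤ t → ∀ l, A t - A (h l t) ≤ H := fun t ht => hdelay t (hT1.trans ht)
  have hY1 := hx.yorkeAbove ht₀ h01 ha₀ hA hc hα hb hh hK hγ hpos hratio' hdelay'
  have hY2 := hx.neg.yorkeAbove ht₀ h01 ha₀ hA hc hα hb hh hK hγ hpos hratio' hdelay'
  have hB := hA.const_mul hα'.le
  have hz : |Real.exp (α * A t) * x t| ≤ Real.exp (α * A t₂) * N' := by
    refine abs_le_of_yorke (z := fun t => Real.exp (α * A t) * x t) hB (by positivity) hY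
      (fun S hS => ?_) hY1 (by simpa only [mul_neg] using hY2) (t₂ := t₂) ?_ ?_ t
    · refine (hA.absolutelyContinuousOnInterval_exp ha₀ α hS).fun_mul
        ((hx.1 S (h01.trans hS)).mono ?_)
      rw [uIcc_of_le hS, uIcc_of_le (h01.trans hS)]
      exact Icc_subset_Icc h01 le_rfl
    · have h1 := hB.rate_le t₁ t₂ (by linarith)
      have h2 : (1 - α) * a₀ * (t₂ - t₁) = 2 * H := by
        rw [ht₂, hδ, add_sub_cancel_left]
        field_simp
      linarith
    · intro s hs
      rw [abs_mul, Real.abs_exp]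
      have := hA.mono ha₀ hs
      have := hx2 s hs
      gcongr
  rw [abs_mul, Real.abs_exp] at hz
  have hgoal : N' * Real.exp (α * a₀ * (T + δ)) * Real.exp (-(α * a₀) * (t - t₀)) =
      Real.exp (L * (T + δ)) * Real.exp (α * a₀ * (T + δ)) * N *
        Real.exp (-(α * a₀) * (t - t₀)) := by rw [hN']; ring
  rw [← hgoal, mul_assoc, ← Real.exp_add]
  have hN'0 : 0 ≤ N' := by positivity
  rcases le_total t t₂ with h | h
  · refine (hx2 t h).trans (le_mul_of_one_le_right hN'0 (Real.one_le_exp ?_))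
    have : 0 ≤ α * a₀ * (T + δ - (t - t₀)) := mul_nonneg (by positivity) (by linarith)
    linarith
  · have h1 := mul_le_mul_of_nonneg_left hz (Real.exp_pos (-(α * A t))).le
    rw [← mul_assoc, ← mul_assoc, ← Real.exp_add, ← Real.exp_add, neg_add_cancel, Real.exp_zero,
      one_mul, mul_comm] at h1
    refine h1.trans ?_
    have h2 : a₀ * (t - t₀ - (T + δ)) ≤ A t - A t₂ :=
      (mul_le_mul_of_nonneg_left (by linarith) ha₀.le).trans (hA.rate_le t₂ t h)
    have h3 := mul_le_mul_of_nonneg_left h2 hα.le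
    have h4 : -(α * A t) + α * A t₂ ≤ α * a₀ * (T + δ) + -(α * a₀) * (t - t₀) := by linarith
    gcongr

theorem corollary1 {m : ℕ} (hm : 0 < m) (a : ℝ → ℝ) (b h : Fin m → ℝ → ℝ)
    (K : Fin m → ℝ → ℝ → ℝ) (a₀ : ℝ) (ha₀ : 0 < a₀)
    (ha : EssBoundedMeasurable a)
    (haa₀ : ∀ᵐ t ∂(volume.restrict (Ici 0)), a₀ ≤ a t)
    (hb : ∀ l, EssBoundedMeasurable (b l))
    (hb_nonneg : ∀ l, ∀ᵐ t ∂(volume.restrict (Ici 0)), 0 ≤ b l t)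
    (hh : ∀ l, IsDelay (h l))
    (hK : ∀ l, IsUnitKernel (h l) (K l))
    (h_finite : IsBoundedUnder (· ≤ ·) atTop (delayIntegral a h))
    (h_ineq : limsupRatio a b = 0 ∨
      Real.log ((limsupRatio a b ^ 2 + limsupRatio a b) / (limsupRatio a b ^ 2 + 1)) <
        1 / limsupRatio a b * Real.exp (-limsupDelay a h)) :
    ExponentiallyStable a b h K := by
  obtain ⟨ham, a₁, ha₁⟩ := ha
  choose hbm b₁ hb₁ using hb
  have hlow := ae_imp_of_ae_restrict haa₀
  have hup := ae_imp_of_ae_restrict ha₁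
  have hbup := ae_all_iff.2 fun l => ae_imp_of_ae_restrict (hb₁ l)
  have hbpos := ae_all_iff.2 fun l => ae_imp_of_ae_restrict (hb_nonneg l)
  have hsum : ∀ᵐ t, 0 ≤ t → ∑ l, b l t ≤ ∑ l, b₁ l := by
    filter_upwards [hbup] with t h1 ht
    exact Finset.sum_le_sum fun l _ => (le_abs_self _).trans (h1 l ht)
  -- Nothing is assumed of `a` on the negative axis; the value `a₀` there makes the primitive a
  -- clock on the whole line.
  set c : ℝ → ℝ := (Ici (0 : ℝ)).piecewise a (fun _ => a₀) with hcdef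
  have hc : ∀ t, 0 ≤ t → c t = a t := fun t ht => piecewise_eq_of_mem _ _ _ ht
  have hc' : ∀ t, ¬ 0 ≤ t → c t = a₀ := fun t ht => piecewise_eq_of_notMem _ _ _ ht
  have hcm : AEStronglyMeasurable c volume :=
    ham.aestronglyMeasurable.piecewise measurableSet_Ici aestronglyMeasurable_const
  obtain ⟨hA, hint⟩ := isClock_integral (c₀ := a₀) (c₁ := max a₀ a₁) hcm ha₀
    (by
      filter_upwards [hlow] with t h1
      by_cases ht : 0 ≤ t
      · rw [hc t ht]; exact h1 ht
      · rw [hc' t ht])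
    (by
      filter_upwards [hup] with t h1
      by_cases ht : 0 ≤ t
      · rw [hc t ht]; exact ((le_abs_self _).trans (h1 ht)).trans (le_max_right _ _)
      · rw [hc' t ht]; exact le_max_left _ _)
  have hInt : ∀ p q, 0 ≤ p → p ≤ q →
      ∫ s in p..q, a s = (∫ s in (0 : ℝ)..q, c s) - ∫ s in (0 : ℝ)..p, c s := by
    intro p q hp hpq
    rw [intervalIntegral.integral_interval_sub_left (hint _ _) (hint _ _)]
    refine intervalIntegral.integral_congr fun s hs => ?_
    rw [uIcc_of_le hpq] at hs
    exact (hc s (hp.trans hs.1)).symm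
  have : Nonempty (Fin m) := ⟨⟨0, hm⟩⟩
  have hmin : ∀ t l, (⨅ l, h l t) ≤ h l t := fun t l => ciInf_le (finite_range _).bddBelow l
  have hev0 : ∀ᶠ t in atTop, 0 ≤ t ∧ 0 ≤ ⨅ l, h l t := by
    filter_upwards [eventually_ge_atTop 0,
      eventually_all.2 fun l => (hh l).2.2.eventually_ge_atTop 0] with t ht hl
    exact ⟨ht, le_ciInf hl⟩
  have hmint : ∀ t, 0 ≤ t → (⨅ l, h l t) ≤ t := fun t ht =>
    (hmin t ⟨0, hm⟩).trans ((hh _).2.1 t ht)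
  have hh₀ : 0 ≤ limsupDelay a h := by
    refine le_limsup_of_frequently_le (Eventually.frequently ?_) h_finite
    filter_upwards [hev0] with t ⟨ht, hmin0⟩
    rw [delayIntegral, hInt _ _ hmin0 (hmint t ht)]
    linarith [hA.mono ha₀ (hmint t ht)]
  obtain ⟨β, H, α, γ, hβ, hH, hα, hα1, hγ, hY⟩ := exists_yorkeCondition hh₀ h_ineq
  have hbdd : IsBoundedUnder (· ≤ ·) (atTop ⊓ ae volume) (fun t => (∑ l, b l t) / a t) := by
    refine ⟨(∑ l, b₁ l) / a₀, eventually_map.2 (eventually_inf.2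
      ⟨Ici 0, Ici_mem_atTop 0, _, hsum.and (hlow.and hbpos), fun t ht => ?_⟩)⟩
    obtain ⟨ht0, h1, h2, h3⟩ := ht
    have hs0 : 0 ≤ ∑ l, b l t := Finset.sum_nonneg fun l _ => h3 l ht0
    exact div_le_div₀ (hs0.trans (h1 ht0)) (h1 ht0) ha₀ (h2 ht0)
  obtain ⟨s, hs, u, hu, hsu⟩ := eventually_inf.1 (eventually_lt_of_limsup_lt hβ hbdd)
  obtain ⟨T, hT⟩ := eventually_atTop.1 ((eventually_lt_of_limsup_lt hH h_finite).and
    (hev0.and hs))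
  refine exponentiallyStable_of_eventually (T := max T 0) (L := max 0 (a₁ + ∑ l, b₁ l))
    (β := β) (H := H) (α := α) (γ := γ)
    (le_max_right _ _) (le_max_left _ _) ha₀ hA hc hα hα1 hb_nonneg hh hK hγ hY ?_ ?_ ?_ ?_
  · filter_upwards [hlow] with t h1 ht using ha₀.le.trans (h1 ht)
  · filter_upwards [hup, hsum] with t h1 h2 ht
    exact (add_le_add (h1 ht) (h2 ht)).trans (le_max_right _ _)
  · filter_upwards [hu, hlow] with t htu h1 ht
    have ht0 : 0 ≤ t := (le_max_right _ _).trans ht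
    have h2 := hsu t ⟨(hT t ((le_max_left _ _).trans ht)).2.2, htu⟩
    exact ((div_lt_iff₀ (ha₀.trans_le (h1 ht0))).1 h2).le
  · intro t ht l
    obtain ⟨h1, ⟨h2, h3⟩, -⟩ := hT t ((le_max_left _ _).trans ht)
    rw [delayIntegral, hInt _ _ h3 (hmint t h2)] at h1
    have := hA.mono ha₀ (hmin t l)
    linarith
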